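/- A mixed hypergraph is a triple $\mathcal H=(X,\mathcal C,\mathcal D)$ with $X$ a finite set and $\mathcal C,\mathcal D$ families of subsets of $X$. A strict $k$-coloring of $\mathcal H$ is a surjective map $c$ from $X$ onto a set of $k$ colors such that every $C\in\mathcal C$ contains two different vertices of the same color and every $D\in\mathcal D$ contains two vertices of different colors. The feasible set $\mathcal F(\mathcal H)$ is the set of all $k$ for which $\mathcal H$ has a strict $k$-coloring, and $r_k$ denotes the number of partitions of $X$ that are the partition into color classes of some strict $k$-coloring of $\mathcal H$. For a set $S$ of positive integers, $\mathcal H$ is a one-realization of $S$ if $\mathcal F(\mathcal H)=S$ and $r_k\in\{0,1\}$ for every $k$. **Theorem.** Let $s\ge 2$, let $n_1>n_2>\cdots>n_s\ge 2$ be integers, and let $S=\{n_1,n_2,\ldots,n_s\}$. Then one-realizations of $S$ exist, and the minimum number $\delta(S)$ of vertices of a one-realization of $S$ is $$\delta(S)=\begin{cases}2n_1-n_s, & \text{if } n_1>n_2+1,\\ 2n_1-n_s-1, & \text{if } n_1=n_2+1.\end{cases}$$ -/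

import Mathlib

universe u

/-- A mixed hypergraph with vertex set `X` (finiteness of `X` is required where it is used):
a family of `C`-edges and a family of `D`-edges, both consisting of subsets of `X`. -/
structure MixedHypergraph (X : Type*) where
  /-- the family of `C`-edges -/
  cEdges : Set (Set X)
  /-- the family of `D`-edges -/
  dEdges : Set (Set X)

namespace MixedHypergraph

/-- A proper `k`-coloring: every `C`-edge has two (different) vertices with a common color and
every `D`-edge has two vertices with distinct colors. -/
def IsProperColoring {X : Type*} (H : MixedHypergraph X) {k : ℕ} (c : X → Fin k) : Prop :=
  (∀ e ∈ H.cEdges, ∃ x ∈ e, ∃ y ∈ e, x ≠ y ∧ c x = c y) ∧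
  (∀ e ∈ H.dEdges, ∃ x ∈ e, ∃ y ∈ e, c x ≠ c y)

/-- A strict `k`-coloring: a proper `k`-coloring that uses all of the `k` colors. -/
def IsStrictColoring {X : Type*} (H : MixedHypergraph X) {k : ℕ} (c : X → Fin k) : Prop :=
  H.IsProperColoring c ∧ Function.Surjective c

/-- The feasible set: all `k` for which there is a strict `k`-coloring. -/
def feasibleSet {X : Type*} (H : MixedHypergraph X) : Set ℕ :=
  {k | ∃ c : X → Fin k, H.IsStrictColoring c}

/-- The feasible partitions into `k` classes: the partitions of the vertex set (given as
equivalence relations) into the color classes of a strict `k`-coloring. -/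
def feasiblePartitions {X : Type*} (H : MixedHypergraph X) (k : ℕ) : Set (Setoid X) :=
  {r | ∃ c : X → Fin k, H.IsStrictColoring c ∧ Setoid.ker c = r}

/-- The entry `r_k` of the chromatic spectrum: the number of feasible partitions into `k`
classes. It is `0` for `k` larger than the upper chromatic number, and at most `1` for `k = 0`. -/
noncomputable def chromaticSpectrum {X : Type*} (H : MixedHypergraph X) (k : ℕ) : ℕ :=
  (H.feasiblePartitions k).ncard

/-- `H` is a realization of `S` if its feasible set is `S`. -/
def IsRealization {X : Type*} (H : MixedHypergraph X) (S : Set ℕ) : Prop :=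
  H.feasibleSet = S

/-- `H` is a one-realization of `S` if it is a realization of `S` and all the entries of its
chromatic spectrum are `0` or `1`. -/
def IsOneRealization {X : Type*} (H : MixedHypergraph X) (S : Set ℕ) : Prop :=
  H.IsRealization S ∧ ∀ k, H.chromaticSpectrum k = 0 ∨ H.chromaticSpectrum k = 1

/-- The set of all sizes (numbers of vertices) of one-realizations of `S` on finite vertex
sets. -/
def oneRealizationSizes (S : Set ℕ) : Set ℕ :=
  {m | ∃ (X : Type u) (_ : Finite X) (H : MixedHypergraph X),
    H.IsOneRealization S ∧ Nat.card X = m}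

end MixedHypergraph

namespace MixedHypergraph

/-- Colorings with an arbitrary finite set of colors may be relabelled. -/
theorem exists_isStrictColoring_ker_eq {X κ : Type*} [Fintype κ] (H : MixedHypergraph X) {k : ℕ}
    (hk : Fintype.card κ = k) (f : X → κ) (hf : Function.Surjective f)
    (hC : ∀ e ∈ H.cEdges, ∃ x ∈ e, ∃ y ∈ e, x ≠ y ∧ f x = f y)
    (hD : ∀ e ∈ H.dEdges, ∃ x ∈ e, ∃ y ∈ e, f x ≠ f y) :
    ∃ c : X → Fin k, H.IsStrictColoring c ∧ Setoid.ker c = Setoid.ker f := by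
  let g := Fintype.equivFinOfCardEq hk
  refine ⟨g ∘ f, ⟨⟨?_, ?_⟩, g.surjective.comp hf⟩, ?_⟩
  · simpa using hC
  · simpa using hD
  · ext x y
    simp [Setoid.ker_def]

/-! ### The lower bound -/

/-- A surjective coloring with `a` colors of `m` vertices has at least `2 * a - m` color classes
of size one. -/
theorem two_mul_le_card_add_card_singletons {X : Type*} [Fintype X] [DecidableEq X] {a : ℕ}
    (c : X → Fin a) (hc : Function.Surjective c) :
    2 * a ≤ Fintype.card X +
      (Finset.univ.filter fun x => ∀ y, c y = c x → y = x).card := by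
  classical
  rw [← Finset.card_univ (α := X),
    Finset.card_eq_sum_card_fiberwise (f := c) (s := Finset.univ) (t := Finset.univ) (by simp),
    Finset.card_eq_sum_card_fiberwise (f := c)
      (s := Finset.univ.filter fun x => ∀ y, c y = c x → y = x) (t := Finset.univ) (by simp),
    ← Finset.sum_add_distrib]
  calc 2 * a = ∑ _i : Fin a, 2 := by simp [mul_comm]
    _ ≤ _ := Finset.sum_le_sum fun i _ => ?_
  obtain ⟨x, rfl⟩ := hc i
  -- Each class contributes at least 2: a singleton is counted both as a vertex and as a singleton,
  -- any other class has two vertices.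
  by_cases hx : ∀ y, c y = c x → y = x
  · have h1 : 0 < (Finset.univ.filter fun y => c y = c x).card :=
      Finset.card_pos.2 ⟨x, by simp⟩
    have h2 : 0 < ((Finset.univ.filter fun x => ∀ y, c y = c x → y = x).filter
        fun y => c y = c x).card := Finset.card_pos.2 ⟨x, by simpa using hx⟩
    omega
  · push Not at hx
    obtain ⟨y, hy, hne⟩ := hx
    have h1 : 1 < (Finset.univ.filter fun y => c y = c x).card :=
      Finset.one_lt_card.2 ⟨y, by simpa using hy, x, by simp, hne⟩
    omega

/-- Two color classes of size one may be merged if some proper coloring identifies them. -/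
theorem exists_merge_singletons {X : Type*} (H : MixedHypergraph X) {a b : ℕ} {c : X → Fin a}
    (hc : H.IsStrictColoring c) {c' : X → Fin b} (hc' : H.IsProperColoring c') {x y : X}
    (hx : ∀ z, c z = c x → z = x) (hy : ∀ z, c z = c y → z = y) (hxy : x ≠ y)
    (h : c' x = c' y) :
    ∃ c'' : X → Fin (a - 1), H.IsStrictColoring c'' ∧
      ∀ u v, c'' u = c'' v ↔ c u = c v ∨ (u = x ∨ u = y) ∧ (v = x ∨ v = y) := by
  classical
  have hcxy : c x ≠ c y := fun e => hxy (hy x e)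
  let f : X → {i : Fin a // i ≠ c y} := fun u =>
    if hu : c u = c y then ⟨c x, hcxy⟩ else ⟨c u, hu⟩
  have hf : ∀ u v, f u = f v ↔ c u = c v ∨ (u = x ∨ u = y) ∧ (v = x ∨ v = y) := by
    intro u v
    by_cases hu : c u = c y <;> by_cases hv : c v = c y <;> simp only [f, hu, hv, dite_true,
      dite_false, Subtype.mk.injEq, true_iff]
    · exact Or.inr ⟨Or.inr (hy u hu), Or.inr (hy v hv)⟩
    · constructor
      · intro e
        exact Or.inr ⟨Or.inr (hy u hu), Or.inl (hx v e.symm)⟩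
      · rintro (e | ⟨-, rfl | rfl⟩)
        · exact absurd e.symm hv
        · rfl
        · exact absurd rfl hv
    · constructor
      · intro e
        exact Or.inr ⟨Or.inl (hx u e), Or.inr (hy v hv)⟩
      · rintro (e | ⟨rfl | rfl, -⟩)
        · exact e.elim
        · rfl
        · exact absurd rfl hu
    · constructor
      · exact Or.inl
      · rintro (e | ⟨rfl | rfl, rfl | rfl⟩)
        · exact e
        · rfl
        · exact absurd rfl hv
        · exact absurd rfl hu
        · rfl
  have hsurj : Function.Surjective f := by
    rintro ⟨i, hi⟩
    obtain ⟨u, rfl⟩ := hc.2 i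
    exact ⟨u, by simp [f, hi]⟩
  have hC : ∀ e ∈ H.cEdges, ∃ x ∈ e, ∃ y ∈ e, x ≠ y ∧ f x = f y := by
    intro e he
    obtain ⟨u, hu, v, hv, huv, e1⟩ := hc.1.1 e he
    exact ⟨u, hu, v, hv, huv, (hf u v).2 (Or.inl e1)⟩
  have hD : ∀ e ∈ H.dEdges, ∃ x ∈ e, ∃ y ∈ e, f x ≠ f y := by
    intro e he
    by_contra! hcon
    obtain ⟨u, hu, v, hv, hne⟩ := hc.1.2 e he
    obtain ⟨p, hp, q, hq, hne'⟩ := hc'.2 e he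
    have huv := ((hf u v).1 (hcon u hu v hv)).resolve_left hne
    -- A D-edge made monochromatic by the merge lies inside `{x, y}`, where `c'` is constant.
    have key : ∀ w ∈ e, w = x ∨ w = y := by
      intro w hw
      rcases (hf u w).1 (hcon u hu w hw) with e1 | e1
      · rcases huv.1 with rfl | rfl
        · exact Or.inl (hx w e1.symm)
        · exact Or.inr (hy w e1.symm)
      · exact e1.2
    rcases key p hp with rfl | rfl <;> rcases key q hq with rfl | rfl <;> simp_all
  obtain ⟨g, hg, hk⟩ := H.exists_isStrictColoring_ker_eq (k := a - 1) (by simp) f hsurj hC hD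
  refine ⟨g, hg, fun u v => ?_⟩
  rw [← hf, ← Setoid.ker_def, hk, Setoid.ker_def]

/-- If a strict `a`-coloring has more classes of size one than a proper coloring has colors, then
`a - 1` is feasible. -/
theorem pred_mem_feasibleSet {X : Type*} [Finite X] (H : MixedHypergraph X) {a b : ℕ}
    (ha : a ∈ H.feasibleSet) (hb : b ∈ H.feasibleSet) (h : Nat.card X + b < 2 * a) :
    a - 1 ∈ H.feasibleSet := by
  classical
  have := Fintype.ofFinite X
  obtain ⟨c, hc⟩ := ha
  obtain ⟨c', hc'⟩ := hb
  have h1 := two_mul_le_card_add_card_singletons c hc.2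
  rw [Nat.card_eq_fintype_card] at h
  obtain ⟨x, hx, y, hy, hne, e⟩ := Finset.exists_ne_map_eq_of_card_lt_of_maps_to
    (s := Finset.univ.filter fun x => ∀ y, c y = c x → y = x) (t := Finset.univ) (f := c')
    (by simp; omega) (by simp)
  simp only [Finset.mem_filter, Finset.mem_univ, true_and] at hx hy
  obtain ⟨g, hg, -⟩ := H.exists_merge_singletons hc hc'.1 hx hy hne e
  exact ⟨g, hg⟩

/-- With one more singleton class the pigeonhole argument still works after one vertex of the first
merged pair is discarded, so two different merges are available. -/
theorem one_lt_chromaticSpectrum_pred {X : Type*} [Finite X] (H : MixedHypergraph X) {a b : ℕ}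
    (ha : a ∈ H.feasibleSet) (hb : b ∈ H.feasibleSet) (h : Nat.card X + b + 1 < 2 * a) :
    1 < H.chromaticSpectrum (a - 1) := by
  classical
  have := Fintype.ofFinite X
  obtain ⟨c, hc⟩ := ha
  obtain ⟨c', hc'⟩ := hb
  have h1 := two_mul_le_card_add_card_singletons c hc.2
  rw [Nat.card_eq_fintype_card] at h
  set T := Finset.univ.filter fun x => ∀ y, c y = c x → y = x with hT
  obtain ⟨x, hx, y, hy, hne, e⟩ := Finset.exists_ne_map_eq_of_card_lt_of_maps_to
    (s := T) (t := Finset.univ) (f := c') (by simp; omega) (by simp)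
  obtain ⟨x', hx', y', hy', hne', e'⟩ := Finset.exists_ne_map_eq_of_card_lt_of_maps_to
    (s := T.erase x) (t := Finset.univ) (f := c')
    (by rw [Finset.card_erase_of_mem hx]; simp; omega) (by simp)
  simp only [hT, Finset.mem_erase, Finset.mem_filter, Finset.mem_univ, true_and] at hx hy hx' hy'
  obtain ⟨g, hg, hgk⟩ := H.exists_merge_singletons hc hc'.1 hx hy hne e
  obtain ⟨g', hg', hgk'⟩ := H.exists_merge_singletons hc hc'.1 hx'.2 hy'.2 hne' e'
  -- Needed because `Set.ncard` is 0 on infinite sets.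
  have : Finite (Setoid X) := Finite.of_injective (fun r : Setoid X => (fun x y => r x y))
    fun r r' hr => Setoid.ext fun x y => by simpa using congrFun₂ hr x y
  refine (Set.one_lt_ncard (Set.toFinite _)).2
    ⟨Setoid.ker g, ⟨g, hg, rfl⟩, Setoid.ker g', ⟨g', hg', rfl⟩, fun hker => ?_⟩
  have h2 : g x' = g y' := by
    rw [← Setoid.ker_def, hker, Setoid.ker_def, hgk']
    simp
  rw [hgk] at h2
  rcases h2 with h2 | ⟨h2, h3⟩
  · exact hne' (hy'.2 x' h2)
  · exact hne' ((h2.resolve_left hx'.1).trans (h3.resolve_left hy'.1).symm)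

/-! ### Mixed hypergraphs spanned by colorings -/

/-- The mixed hypergraph with all edges that are respected by each of the colorings `p n`,
`n ∈ S`. -/
def ofColorings {X : Type*} (S : Set ℕ) (p : ℕ → X → ℕ) : MixedHypergraph X where
  cEdges := {e | ∀ n ∈ S, ∃ x ∈ e, ∃ y ∈ e, x ≠ y ∧ p n x = p n y}
  dEdges := {e | ∀ n ∈ S, ∃ x ∈ e, ∃ y ∈ e, p n x ≠ p n y}

/-- A family of colorings is closed if it contains, up to relabelling, every coloring whose
rainbow sets and monochromatic sets are rainbow and monochromatic for some member. -/
def IsClosedFamily {X : Type*} (S : Set ℕ) (p : ℕ → X → ℕ) : Prop :=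
  ∀ c : X → ℕ, (∀ T : Set X, Set.InjOn c T → ∃ n ∈ S, Set.InjOn (p n) T) →
    (∀ T : Set X, (∀ x ∈ T, ∀ y ∈ T, c x = c y) →
      ∃ n ∈ S, ∀ x ∈ T, ∀ y ∈ T, p n x = p n y) →
    ∃ n ∈ S, ∀ x y, c x = c y ↔ p n x = p n y

/-- Moves the construction on `Fin a ⊕ Fin d` to an arbitrary universe. -/
theorem IsClosedFamily.comp_down {X : Type*} {S : Set ℕ} {p : ℕ → X → ℕ}
    (h : IsClosedFamily S p) :
    IsClosedFamily S fun n (x : ULift.{u} X) => p n x.down := by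
  intro c hC hD
  obtain ⟨n, hn, hc⟩ := h (c ∘ ULift.up) (fun T hT => by
    obtain ⟨n, hn, h'⟩ := hC (ULift.down ⁻¹' T) fun x hx y hy e =>
      ULift.down_injective (hT hx hy e)
    exact ⟨n, hn, fun x hx y hy e => congrArg ULift.down (@h' ⟨x⟩ hx ⟨y⟩ hy e)⟩)
    (fun T hT => by
    obtain ⟨n, hn, h'⟩ := hD (ULift.down ⁻¹' T) fun x hx y hy => hT _ hx _ hy
    exact ⟨n, hn, fun x hx y hy => h' ⟨x⟩ hx ⟨y⟩ hy⟩)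
  exact ⟨n, hn, fun x y => hc x.down y.down⟩

/-- A rainbow set of a strict coloring is not a C-edge, so some `p n` is injective on it; a
monochromatic set is not a D-edge, so some `p n` is constant on it. Closedness then leaves only the
given partitions. -/
theorem IsClosedFamily.isOneRealization {X : Type*} {S : Set ℕ} {p : ℕ → X → ℕ}
    (h : IsClosedFamily S p) (hp : ∀ n ∈ S, Set.range (p n) = Set.Iio n) :
    (ofColorings S p).IsOneRealization S := by
  have hfeas : ∀ n ∈ S, ∃ c : X → Fin n, (ofColorings S p).IsStrictColoring c := by
    intro n hn
    have hlt : ∀ x, p n x < n := fun x => (hp n hn).subset ⟨x, rfl⟩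
    refine ⟨fun x => ⟨p n x, hlt x⟩, ⟨⟨?_, ?_⟩, ?_⟩⟩
    · intro e he
      simpa using he n hn
    · intro e he
      simpa using he n hn
    · rintro ⟨i, hi⟩
      obtain ⟨x, hx⟩ := (hp n hn).superset hi
      exact ⟨x, Fin.ext hx⟩
  have hker : ∀ k (c : X → Fin k), (ofColorings S p).IsStrictColoring c →
      k ∈ S ∧ Setoid.ker c = Setoid.ker (p k) := by
    intro k c hc
    have hC : ∀ T : Set X, Set.InjOn (fun x => (c x : ℕ)) T → ∃ n ∈ S, Set.InjOn (p n) T := by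
      intro T hT
      by_contra! hcon
      obtain ⟨x, hx, y, hy, hne, e⟩ := hc.1.1 T fun n hn => by
        have := hcon n hn
        simp only [Set.InjOn] at this
        push Not at this
        obtain ⟨x, hx, y, hy, e, hne⟩ := this
        exact ⟨x, hx, y, hy, hne, e⟩
      exact hne (hT hx hy (congrArg Fin.val e))
    have hD : ∀ T : Set X, (∀ x ∈ T, ∀ y ∈ T, (c x : ℕ) = c y) →
        ∃ n ∈ S, ∀ x ∈ T, ∀ y ∈ T, p n x = p n y := by
      intro T hT
      by_contra! hcon
      obtain ⟨x, hx, y, hy, hne⟩ := hc.1.2 T hcon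
      exact hne (Fin.ext (hT x hx y hy))
    obtain ⟨n, hn, hcn⟩ := h (fun x => c x) hC hD
    -- Both numbers count the classes of the same partition.
    have hkn : k = n := by
      have e1 : Nat.card (Quotient (Setoid.ker c)) = k := by
        rw [Nat.card_congr (Setoid.quotientKerEquivOfSurjective c hc.2), Nat.card_fin]
      have e2 : Nat.card (Quotient (Setoid.ker (p n))) = n := by
        rw [Nat.card_congr (Setoid.quotientKerEquivRange (p n)), hp n hn]
        simp
      have e3 : Setoid.ker c = Setoid.ker (p n) := by
        ext x y
        rw [Setoid.ker_def, Setoid.ker_def, ← hcn, Fin.ext_iff]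
      rw [← e1, e3, e2]
    subst hkn
    refine ⟨hn, ?_⟩
    ext x y
    rw [Setoid.ker_def, Setoid.ker_def, ← hcn, Fin.ext_iff]
  constructor
  · ext k
    exact ⟨fun ⟨c, hc⟩ => (hker k c hc).1, hfeas k⟩
  · intro k
    have hsub : (ofColorings S p).feasiblePartitions k ⊆ {Setoid.ker (p k)} := by
      rintro _ ⟨c, hc, rfl⟩
      exact (hker k c hc).2
    have := Set.ncard_le_ncard hsub
    rw [Set.ncard_singleton] at this
    unfold chromaticSpectrum
    omega

/-! ### The construction -/

/-- The level of a vertex. -/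
def level {a : ℕ} (b : ℕ) {d : ℕ} : Fin a ⊕ Fin d → ℕ :=
  Sum.elim (fun j => j) (fun j => b + j)

/-- The color that a vertex has in the colorings with at most `level` many colors. -/
def sideColor {a d : ℕ} : Fin a ⊕ Fin d → ℕ :=
  Sum.elim (fun _ => 0) (fun _ => 1)

/-- The coloring with `n` colors: vertices of level below `n` are colored by their level, all the
others by `0` or `1` according to their side. -/
def levelColoring {a : ℕ} (b : ℕ) {d : ℕ} (n : ℕ) (x : Fin a ⊕ Fin d) : ℕ :=
  if level b x < n then level b x else sideColor x

section Construction

variable {a b d : ℕ}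

@[simp] theorem level_inl (j : Fin a) : level b (Sum.inl j : Fin a ⊕ Fin d) = j := rfl

@[simp] theorem level_inr (j : Fin d) : level b (Sum.inr j : Fin a ⊕ Fin d) = b + j := rfl

@[simp] theorem sideColor_inl (j : Fin a) : sideColor (Sum.inl j : Fin a ⊕ Fin d) = 0 := rfl

@[simp] theorem sideColor_inr (j : Fin d) : sideColor (Sum.inr j : Fin a ⊕ Fin d) = 1 := rfl

theorem sideColor_le_one (x : Fin a ⊕ Fin d) : sideColor x ≤ 1 := by
  rcases x with j | j <;> simp

theorem levelColoring_cases (b n : ℕ) (x : Fin a ⊕ Fin d) :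
    level b x < n ∧ levelColoring b n x = level b x ∨
      n ≤ level b x ∧ levelColoring b n x = sideColor x := by
  unfold levelColoring
  split_ifs <;> omega

theorem levelColoring_lt {n : ℕ} (hn : 2 ≤ n) (x : Fin a ⊕ Fin d) : levelColoring b n x < n := by
  have := sideColor_le_one x
  unfold levelColoring
  split_ifs <;> omega

theorem range_levelColoring {n : ℕ} (hn : 2 ≤ n) (hna : n ≤ a) :
    Set.range (levelColoring b n : Fin a ⊕ Fin d → ℕ) = Set.Iio n := by
  ext i
  constructor
  · rintro ⟨x, rfl⟩
    exact levelColoring_lt hn x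
  · intro hi
    have hi : i < n := hi
    exact ⟨Sum.inl ⟨i, by omega⟩, by simp [levelColoring, hi]⟩

/-! ### Closedness of the level colorings -/

/-- If `c` identifies the two vertices of each level from `b` on and below `k`, then a vertex of
level below `k` has a color class that is monochromatic for some `levelColoring b n` with `n`
larger than the level. -/
theorem exists_levelColoring_class {S : Set ℕ} (hbS : ∀ n ∈ S, b ≤ n) {c : Fin a ⊕ Fin d → ℕ}
    (hD : ∀ T : Set (Fin a ⊕ Fin d), (∀ x ∈ T, ∀ y ∈ T, c x = c y) →
      ∃ n ∈ S, ∀ x ∈ T, ∀ y ∈ T, levelColoring b n x = levelColoring b n y)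
    {k : ℕ} (hkd : k ≤ b + d) (hk : ∀ (i : Fin a) (j : Fin d), (i : ℕ) = b + j → (i : ℕ) < k →
      c (Sum.inl i) = c (Sum.inr j)) (hda : b + d ≤ a) (x : Fin a ⊕ Fin d) (hx : level b x < k) :
    ∃ n ∈ S, level b x < n ∧ ∀ y, c y = c x → levelColoring b n y = level b x := by
  obtain ⟨n, hn, h⟩ := hD {y | c y = c x} fun y hy z hz => Eq.trans hy (Eq.symm hz)
  have hlt : level b x < n := by
    -- Otherwise `b ≤ n ≤ level b x`, so the class of `x` contains both vertices of its level, which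
    -- `levelColoring b n` colors 0 and 1.
    by_contra hcon
    have hbn := hbS n hn
    have hi : level b x < a := by omega
    have hj : level b x - b < d := by omega
    have e := hk ⟨level b x, hi⟩ ⟨level b x - b, hj⟩ (by simp; omega) hx
    have h0 : c (Sum.inl ⟨level b x, hi⟩) = c x ∧ c (Sum.inr ⟨level b x - b, hj⟩) = c x := by
      rcases x with i | j
      · exact ⟨rfl, e.symm⟩
      · have : (⟨level b (Sum.inr j : Fin a ⊕ Fin d) - b, hj⟩ : Fin d) = j := by
          ext; simp
        rw [this] at e ⊢
        exact ⟨e, rfl⟩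
    have h1 := h _ h0.1 _ h0.2
    have h2 : ¬ b + (level b x - b) < n := by omega
    simp [levelColoring, hcon, h2] at h1
  refine ⟨n, hn, hlt, fun y hy => ?_⟩
  rw [h y hy x rfl, levelColoring, if_pos hlt]

theorem apply_eq_of_level_eq {c : Fin a ⊕ Fin d → ℕ} {k : ℕ}
    (hk : ∀ (i : Fin a) (j : Fin d), (i : ℕ) = b + j → (i : ℕ) < k →
      c (Sum.inl i) = c (Sum.inr j)) {x y : Fin a ⊕ Fin d} (hx : level b x < k)
    (h : level b x = level b y) : c x = c y := by
  rcases x with i | i <;> rcases y with j | j <;> simp only [level_inl, level_inr] at h hx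
  · rw [Fin.ext h]
  · exact hk i j h hx
  · exact (hk j i h.symm (by omega)).symm
  · rw [Fin.ext (Nat.add_left_cancel h)]

/-- The case of the closedness of the family of level colorings in which `k` is the least level
with two vertices of different colors. -/
theorem eq_levelColoring_of_least_split {S : Set ℕ} (hb : 2 ≤ b) (hda : b + d ≤ a)
    (hbS : ∀ n ∈ S, b ≤ n) {c : Fin a ⊕ Fin d → ℕ}
    (hC : ∀ T : Set (Fin a ⊕ Fin d), Set.InjOn c T →
      ∃ n ∈ S, Set.InjOn (levelColoring b n) T)
    (hD : ∀ T : Set (Fin a ⊕ Fin d), (∀ x ∈ T, ∀ y ∈ T, c x = c y) →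
      ∃ n ∈ S, ∀ x ∈ T, ∀ y ∈ T, levelColoring b n x = levelColoring b n y)
    {k : Fin a} {k' : Fin d} (hkk : (k : ℕ) = b + k')
    (hsplit : c (Sum.inl k) ≠ c (Sum.inr k'))
    (hk : ∀ (i : Fin a) (j : Fin d), (i : ℕ) = b + j → (i : ℕ) < k →
      c (Sum.inl i) = c (Sum.inr j)) :
    (k : ℕ) ∈ S ∧ ∀ x y, c x = c y ↔ levelColoring b k x = levelColoring b k y := by
  have hkd : (k : ℕ) ≤ b + d := by omega
  have hclass := exists_levelColoring_class hbS hD hkd hk hda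
  -- A transversal of the expected `k` classes. The split pair represents colors 0 and 1, as it
  -- forces `n ≤ k` for every `levelColoring b n` injective on the transversal.
  let rep : Fin k → Fin a ⊕ Fin d := fun l =>
    if (l : ℕ) = 0 then Sum.inl k else if (l : ℕ) = 1 then Sum.inr k' else Sum.inl ⟨l, by omega⟩
  have hrep0 : ∀ l : Fin k, (l : ℕ) = 0 → rep l = Sum.inl k := fun l hl => by simp [rep, hl]
  have hrep1 : ∀ l : Fin k, (l : ℕ) = 1 → rep l = Sum.inr k' := fun l hl => by simp [rep, hl]
  have hrep2 : ∀ l : Fin k, 2 ≤ (l : ℕ) → rep l = Sum.inl ⟨l, by omega⟩ := fun l hl => by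
    simp only [rep]
    rw [if_neg (by omega), if_neg (by omega)]
  -- the only vertices that share a color with `rep l` where `2 ≤ l` have level `l`
  have hmid : ∀ l : Fin k, 2 ≤ (l : ℕ) → ∀ x, c x = c (rep l) → level b x = l := by
    intro l hl x hx
    rw [hrep2 l hl] at hx
    obtain ⟨n, hn, hlt, h⟩ := hclass (Sum.inl ⟨l, by omega⟩) (by simp)
    have h1 := h x hx
    have := sideColor_le_one x
    simp only [levelColoring, level_inl] at h1
    split_ifs at h1 <;> omega
  have hinj : Function.Injective (c ∘ rep) := by
    have main : ∀ l l' : Fin k, (l : ℕ) < l' → c (rep l) ≠ c (rep l') := by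
      intro l l' hll e
      by_cases h2 : 2 ≤ (l' : ℕ)
      · have h3 := hmid l' h2 _ e
        rcases Nat.lt_or_ge (l : ℕ) 2 with h4 | h4
        · rcases (by omega : (l : ℕ) = 0 ∨ (l : ℕ) = 1) with h5 | h5
          · rw [hrep0 l h5, level_inl] at h3
            omega
          · rw [hrep1 l h5, level_inr] at h3
            omega
        · rw [hrep2 l h4, level_inl] at h3
          simp at h3
          omega
      · rw [hrep0 l (by omega), hrep1 l' (by omega)] at e
        exact hsplit e
    intro l l' e
    rcases lt_trichotomy (l : ℕ) l' with h | h | h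
    · exact absurd e (main l l' h)
    · exact Fin.ext h
    · exact absurd e.symm (main l' l h)
  have hk2 : 2 ≤ (k : ℕ) := by omega
  have hle : ∀ n, levelColoring b n (Sum.inl k : Fin a ⊕ Fin d) ≠
      levelColoring b n (Sum.inr k' : Fin a ⊕ Fin d) → n ≤ k := by
    intro n h
    by_contra hcon
    have h2 : b + (k' : ℕ) < n := by omega
    simp [levelColoring, h2, hkk] at h
  have hmem0 : Sum.inl k ∈ Set.range rep := ⟨⟨0, by omega⟩, hrep0 _ rfl⟩
  have hmem1 : Sum.inr k' ∈ Set.range rep := ⟨⟨1, by omega⟩, hrep1 _ rfl⟩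
  have hkS : (k : ℕ) ∈ S := by
    obtain ⟨n, hn, h⟩ := hC (Set.range rep) (by
      rintro _ ⟨l, rfl⟩ _ ⟨l', rfl⟩ e
      exact congrArg rep (hinj e))
    have h1 : n ≤ k := hle n fun e => by simpa using h hmem0 hmem1 e
    have h2 : (k : ℕ) ≤ n := by
      have := Fintype.card_le_of_injective
        (fun l : Fin k => (⟨levelColoring b n (rep l),
          levelColoring_lt (hb.trans (hbS n hn)) _⟩ : Fin n)) (fun l l' e => by
            simp only [Fin.mk.injEq] at e
            exact hinj (congrArg c (h ⟨l, rfl⟩ ⟨l', rfl⟩ e)))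
      simpa using this
    rwa [← le_antisymm h1 h2]
  -- A vertex of a new color would give a rainbow set of `k + 1` vertices, yet the split pair in it
  -- still forces `n ≤ k`.
  have hcover : ∀ x, ∃ l, c x = c (rep l) := by
    intro x
    by_contra! hx
    obtain ⟨n, hn, h⟩ := hC (insert x (Set.range rep)) (by
      rintro _ (rfl | ⟨l, rfl⟩) _ (rfl | ⟨l', rfl⟩) e
      · rfl
      · exact absurd e (hx l')
      · exact absurd e.symm (hx l)
      · exact congrArg rep (hinj e))
    have h1 : n ≤ k := hle n fun e => by simpa using h (Or.inr hmem0) (Or.inr hmem1) e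
    have := Fintype.card_le_of_injective
      (fun o : Option (Fin k) => (⟨levelColoring b n (o.elim x rep),
        levelColoring_lt (hb.trans (hbS n hn)) _⟩ : Fin n)) (fun o o' e => by
          simp only [Fin.mk.injEq] at e
          have e' := h (by cases o <;> simp) (by cases o' <;> simp) e
          cases o <;> cases o'
          · rfl
          · exact absurd (congrArg c e') (hx _)
          · exact absurd (congrArg c e').symm (hx _)
          · exact congrArg some (hinj (congrArg c e')))
    simp at this
    omega
  have hval : ∀ x, c x = c (rep ⟨levelColoring b k x, levelColoring_lt hk2 x⟩) := by
    intro x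
    obtain ⟨l, hl⟩ := hcover x
    suffices h : levelColoring b k x = l by
      rw [hl]
      congr 2
      exact Fin.ext h.symm
    by_cases h2 : 2 ≤ (l : ℕ)
    · have := hmid l h2 x hl
      rw [levelColoring, if_pos (by omega), this]
    · have hlow : level b x < k → level b x ≤ 1 := by
        intro hlt
        by_contra hcon
        have e1 : c x = c (rep ⟨level b x, hlt⟩) :=
          apply_eq_of_level_eq hk hlt (by rw [hrep2 _ (by simp; omega)]; simp)
        have e2 := hinj (hl.symm.trans e1)
        rw [e2] at h2
        simp at h2
        omega
      -- Some level coloring agrees on `x` and `rep l`. If `n > k`, this forces `x = rep l`;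
      -- otherwise `x` has color `l` there, so its level is `l`, or it lies on the side of `rep l`
      -- at a level that `hlow` puts at `k` or above.
      obtain ⟨n, hn, h⟩ := hD {x, rep l} (by
        rintro y (rfl | rfl) z (rfl | rfl) <;> simp [hl])
      have hnb := hbS n hn
      have h7 := levelColoring_cases b n x
      have h8 := levelColoring_cases b k x
      have h3 := h x (by simp) (rep l) (by simp)
      rcases (by omega : (l : ℕ) = 0 ∨ (l : ℕ) = 1) with h5 | h5
      · rw [hrep0 l h5] at h3 hl
        have hne : x ≠ Sum.inr k' := by
          rintro rfl
          exact hsplit hl.symm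
        have h6 := levelColoring_cases b n (Sum.inl k : Fin a ⊕ Fin d)
        rcases x with j | j
        · simp only [level_inl, sideColor_inl] at *
          omega
        · have : (j : ℕ) ≠ k' := fun e => hne (by rw [Fin.ext e])
          simp only [level_inl, level_inr, sideColor_inl, sideColor_inr] at *
          omega
      · rw [hrep1 l h5] at h3 hl
        have hne : x ≠ Sum.inl k := by
          rintro rfl
          exact hsplit hl
        have h6 := levelColoring_cases b n (Sum.inr k' : Fin a ⊕ Fin d)
        rcases x with j | j
        · have : (j : ℕ) ≠ k := fun e => hne (by rw [Fin.ext e])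
          simp only [level_inl, level_inr, sideColor_inl, sideColor_inr] at *
          omega
        · simp only [level_inr, sideColor_inr] at *
          omega
  refine ⟨hkS, fun x y => ⟨fun e => ?_, fun e => ?_⟩⟩
  · rw [hval x, hval y] at e
    exact congrArg Fin.val (hinj e)
  · rw [hval x, hval y]
    simp only [e]

/-- The level colorings form a closed family, where the top level may lack its second vertex if
the set of sizes contains `a - 1`. -/
theorem isClosedFamily_levelColoring {S : Set ℕ} (hb : 2 ≤ b) (hbS : ∀ n ∈ S, b ≤ n)
    (haS : a ∈ S) (hd : b + d = a ∨ b + d + 1 = a ∧ b + d ∈ S) :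
    IsClosedFamily S (levelColoring b : ℕ → Fin a ⊕ Fin d → ℕ) := by
  intro c hC hD
  have hda : b + d ≤ a := by omega
  by_cases hs : ∃ m : ℕ, ∃ (i : Fin a) (j : Fin d), (i : ℕ) = m ∧ (i : ℕ) = b + j ∧
      c (Sum.inl i) ≠ c (Sum.inr j)
  · classical
    obtain ⟨i, j, hi, hij, hne⟩ := Nat.find_spec hs
    refine ⟨i, eq_levelColoring_of_least_split hb hda hbS hC hD hij hne ?_⟩
    intro i' j' h1 h2
    by_contra h3
    exact Nat.find_min hs (hi ▸ h2) ⟨i', j', rfl, h1, h3⟩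
  · have hk : ∀ (i : Fin a) (j : Fin d), (i : ℕ) = b + j → (i : ℕ) < b + d →
        c (Sum.inl i) = c (Sum.inr j) := by
      intro i j h1 _
      by_contra h2
      exact hs ⟨i, i, j, rfl, h1, h2⟩
    have hclass := exists_levelColoring_class hbS hD le_rfl hk hda
    have hlow : ∀ x y, level b x < b + d → level b y < b + d →
        (c x = c y ↔ level b x = level b y) := by
      intro x y hx hy
      refine ⟨fun e => ?_, apply_eq_of_level_eq hk hx⟩
      rcases le_total (level b y) (level b x) with hle | hle
      · obtain ⟨n, -, hlt, h⟩ := hclass x hx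
        have := h y e.symm
        rw [levelColoring, if_pos (by omega)] at this
        exact this.symm
      · obtain ⟨n, -, hlt, h⟩ := hclass y hy
        have := h x e
        rwa [levelColoring, if_pos (by omega)] at this
    rcases hd with hd | ⟨hd, hdS⟩
    · have hlt : ∀ x : Fin a ⊕ Fin d, level b x < a := by
        rintro (j | j) <;> simp only [level_inl, level_inr] <;> omega
      refine ⟨a, haS, fun x y => ?_⟩
      rw [hlow x y (hd ▸ hlt x) (hd ▸ hlt y), levelColoring, levelColoring, if_pos (hlt x),
        if_pos (hlt y)]
    · have htop : ∀ x : Fin a ⊕ Fin d, level b x < b + d ∨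
          x = Sum.inl ⟨b + d, by omega⟩ := by
        rintro (j | j)
        · rcases Nat.lt_or_ge (j : ℕ) (b + d) with h | h
          · exact Or.inl h
          · exact Or.inr (congrArg Sum.inl (Fin.ext (by simp; omega)))
        · exact Or.inl (by simp)
      set z : Fin a ⊕ Fin d := Sum.inl ⟨b + d, by omega⟩ with hz
      have hzl : level b z = b + d := rfl
      have hzs : sideColor z = 0 := rfl
      -- The unpaired top vertex `z` can only join the class of level 0: it is on the left, so
      -- collapsing it gives color 0.
      have hzero : ∀ y, level b y < b + d → c z = c y → level b y = 0 := by
        intro y hy e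
        obtain ⟨n, -, hlt, h⟩ := hclass y hy
        have := h z e
        rw [levelColoring, hzl, hzs] at this
        split_ifs at this <;> omega
      by_cases hz0 : c z = c (Sum.inl ⟨0, by omega⟩)
      · have hzy : ∀ y, level b y < b + d → (c z = c y ↔ level b y = 0) := fun y hy =>
          ⟨hzero y hy, fun h => hz0.trans (apply_eq_of_level_eq hk (by simp; omega)
            (by simp [h]))⟩
        have hcz : levelColoring b (b + d) z = 0 := by simp [levelColoring, hzl, hzs]
        refine ⟨b + d, hdS, fun x y => ?_⟩
        rcases htop x with hx | rfl <;> rcases htop y with hy | rfl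
        · rw [hlow x y hx hy, levelColoring, levelColoring, if_pos hx, if_pos hy]
        · rw [eq_comm, hzy x hx, hcz, levelColoring, if_pos hx]
        · rw [hzy y hy, hcz, levelColoring, if_pos hy, eq_comm]
        · simp
      · have hlt : ∀ x : Fin a ⊕ Fin d, level b x < a := by
          rintro (j | j) <;> simp only [level_inl, level_inr] <;> omega
        have hzy : ∀ y, level b y < b + d → c z ≠ c y := fun y hy e =>
          hz0 (e.trans (apply_eq_of_level_eq hk hy (by simp [hzero y hy e])))
        refine ⟨a, haS, fun x y => ?_⟩
        rw [levelColoring, levelColoring, if_pos (hlt x), if_pos (hlt y)]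
        rcases htop x with hx | rfl <;> rcases htop y with hy | rfl
        · exact hlow x y hx hy
        · exact iff_of_false (fun e => hzy x hx e.symm) (by omega)
        · exact iff_of_false (hzy y hy) (by omega)
        · simp

end Construction

/-! ### Combining the construction with the lower bound -/

theorem mem_oneRealizationSizes {S : Set ℕ} {a b d : ℕ} (hb : 2 ≤ b) (hbS : ∀ n ∈ S, b ≤ n)
    (hSa : ∀ n ∈ S, n ≤ a) (haS : a ∈ S) (hd : b + d = a ∨ b + d + 1 = a ∧ b + d ∈ S) :
    a + d ∈ oneRealizationSizes.{u} S := by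
  refine ⟨ULift.{u} (Fin a ⊕ Fin d), inferInstance, _,
    (isClosedFamily_levelColoring hb hbS haS hd).comp_down.isOneRealization ?_, by simp⟩
  intro n hn
  rw [← range_levelColoring (b := b) (d := d) (hb.trans (hbS n hn)) (hSa n hn)]
  exact ULift.down_surjective.range_comp (levelColoring b n)

end MixedHypergraph

theorem theorem1p1 (s : ℕ) (hs : 2 ≤ s) (n : ℕ → ℕ)
    (hn : StrictAntiOn n (Set.Icc 1 s)) (hns : 2 ≤ n s) :
    (n 1 > n 2 + 1 →
      IsLeast (MixedHypergraph.oneRealizationSizes.{u} (n '' Set.Icc 1 s))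
        (2 * n 1 - n s)) ∧
    (n 1 = n 2 + 1 →
      IsLeast (MixedHypergraph.oneRealizationSizes.{u} (n '' Set.Icc 1 s))
        (2 * n 1 - n s - 1)) := by
  have m1 : 1 ∈ Set.Icc 1 s := ⟨le_rfl, by omega⟩
  have m2 : 2 ∈ Set.Icc 1 s := ⟨by omega, hs⟩
  have ms : s ∈ Set.Icc 1 s := ⟨by omega, le_rfl⟩
  have hanti := hn.antitoneOn
  have h2s : n s ≤ n 2 := hanti m2 ms hs
  have h12 : n 2 < n 1 := hn m1 m2 (by omega)
  have hbS : ∀ k ∈ n '' Set.Icc 1 s, n s ≤ k := by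
    rintro _ ⟨i, hi, rfl⟩
    exact hanti hi ms hi.2
  have hSa : ∀ k ∈ n '' Set.Icc 1 s, k ≤ n 1 := by
    rintro _ ⟨i, hi, rfl⟩
    exact hanti m1 hi hi.1
  have hS : ∀ i ∈ Set.Icc 1 s, n i ∈ n '' Set.Icc 1 s := fun i hi => ⟨i, hi, rfl⟩
  refine ⟨fun h => ⟨?_, ?_⟩, fun h => ⟨?_, ?_⟩⟩
  · convert MixedHypergraph.mem_oneRealizationSizes (d := n 1 - n s) hns hbS hSa (hS 1 m1) (Or.inl (by omega))
      using 1
    omega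
  · rintro _ ⟨X, _, H, ⟨hF, -⟩, rfl⟩
    have hF : H.feasibleSet = n '' Set.Icc 1 s := hF
    by_contra hlt
    have hmem := H.pred_mem_feasibleSet (hF ▸ hS 1 m1) (hF ▸ hS s ms) (by omega)
    rw [hF] at hmem
    obtain ⟨i, hi, e⟩ := hmem
    rcases (by have := hi.1; omega : i = 1 ∨ 2 ≤ i) with rfl | h2
    · omega
    · have := hanti m2 hi h2
      omega
  -- Here `n 2 = n 1 - 1` lies in `S`, so the top level may lack its right vertex, which saves one
  -- vertex.
  · convert MixedHypergraph.mem_oneRealizationSizes (d := n 2 - n s) hns hbS hSa (hS 1 m1)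
      (Or.inr ⟨by omega, by rw [Nat.add_sub_cancel' h2s]; exact hS 2 m2⟩) using 1
    omega
  · rintro _ ⟨X, _, H, ⟨hF, hone⟩, rfl⟩
    have hF : H.feasibleSet = n '' Set.Icc 1 s := hF
    by_contra hlt
    have := H.one_lt_chromaticSpectrum_pred (hF ▸ hS 1 m1) (hF ▸ hS s ms) (by omega)
    have := hone (n 1 - 1)
    omega
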